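/- Let all spaces be over $\mathbb K=\mathbb R$ or $\mathbb K=\mathbb C$. For $0<s\le 1$, a bounded operator $T:X\to Y$ between Banach spaces is called $s$-nuclear if there are $(x_k')\subset X^*$ and $(y_k)\subset Y$ with $\sum_{k=1}^\infty\|x_k'\|^s\|y_k\|^s<\infty$ and $Tx=\sum_{k=1}^\infty\langle x_k',x\rangle y_k$ for all $x\in X$. For $0<p<\infty$ and a Hilbert space $H$, let $S_p(H)$ be the von Neumann–Schatten class of compact operators $U:H\to H$ whose singular values $(\mu_n)$ satisfy $\sum_n\mu_n^p<\infty$. A bounded operator $T:X\to Y$ factors through an $S_p(H)$-operator if there are a Hilbert space $H$, bounded operators $A:X\to H$ and $B:H\to Y$, and $U\in S_p(H)$ with $T=BUA$. Let $s,q\in(0,1]$ and let $r$ be given by $1/r=1/s+1/q-3/2$. If $X,Y,Z$ are Banach spaces, $T_1:X\to Y$ is $s$-nuclear and $T_2:Y\to Z$ is $q$-nuclear, then the product $T_2T_1$ factors through an $S_r(H)$-operator. The exponent $r$ is sharp: for all $s,q\in(0,1]$ there exist Banach spaces $X,Y,Z$, an $s$-nuclear operator $T_1:X\to Y$ and a $q$-nuclear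 operator $T_2:Y\to Z$ such that, for no $p$ with $0<p<r$, the product $T_2T_1$ factors through an $S_p(H)$-operator. -/

import Mathlib

universe h u v w

/-- A bounded operator `T : X → Y` is `s`-nuclear if `T x = ∑ₖ ⟨x'ₖ, x⟩ yₖ` for all `x`, where
`∑ₖ ‖x'ₖ‖ ^ s * ‖yₖ‖ ^ s < ∞`. -/
def IsSNuclear {𝕜 : Type} [RCLike 𝕜]
    {X : Type u} [NormedAddCommGroup X] [NormedSpace 𝕜 X]
    {Y : Type v} [NormedAddCommGroup Y] [NormedSpace 𝕜 Y]
    (s : ℝ) (T : X →L[𝕜] Y) : Prop :=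
  ∃ (x' : ℕ → (X →L[𝕜] 𝕜)) (y : ℕ → Y),
    Summable (fun k => ‖x' k‖ ^ s * ‖y k‖ ^ s) ∧
    ∀ x : X, HasSum (fun k => x' k x • y k) (T x)

/-- Canonical form (singular value decomposition) of an operator on a Hilbert space:
`U x = ∑ᵢ μᵢ ⟨eᵢ, x⟩ fᵢ` with orthonormal families `e` and `f` and positive numbers `μ`.
For compact `U`, the family `μ` lists the nonzero singular values of `U`, that is, the nonzero
eigenvalues of `|U|`, repeated according to multiplicity. -/
structure IsSingularDecomposition {𝕜 : Type} [RCLike 𝕜]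
    {H : Type h} [NormedAddCommGroup H] [InnerProductSpace 𝕜 H]
    (U : H →L[𝕜] H) {ι : Type} (e f : ι → H) (μ : ι → ℝ) : Prop where
  orthonormal_left : Orthonormal 𝕜 e
  orthonormal_right : Orthonormal 𝕜 f
  pos : ∀ i, 0 < μ i
  hasSum : ∀ x : H, HasSum (fun i => ((μ i : 𝕜) * inner 𝕜 (e i) x) • f i) (U x)

/-- The von Neumann–Schatten class `S_p(H)`: compact operators whose singular values are
`p`-summable. (Zero singular values do not contribute to the sum, since `p > 0`.) -/
def IsSchattenClass {𝕜 : Type} [RCLike 𝕜]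
    {H : Type h} [NormedAddCommGroup H] [InnerProductSpace 𝕜 H]
    (p : ℝ) (U : H →L[𝕜] H) : Prop :=
  IsCompactOperator U ∧
    ∃ (ι : Type) (e f : ι → H) (μ : ι → ℝ),
      IsSingularDecomposition U e f μ ∧ Summable (fun i => μ i ^ p)

/-- `T : X → Y` factors through an operator of class `S_p(H)`: there are a Hilbert space `H` and
bounded operators `A : X → H`, `U ∈ S_p(H)`, `B : H → Y` with `T = B U A`. -/
def FactorsThroughSchatten.{a, b, c} {𝕜 : Type} [RCLike 𝕜]
    {X : Type b} [NormedAddCommGroup X] [NormedSpace 𝕜 X]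
    {Y : Type c} [NormedAddCommGroup Y] [NormedSpace 𝕜 Y]
    (p : ℝ) (T : X →L[𝕜] Y) : Prop :=
  ∃ (H : Type a) (_ : NormedAddCommGroup H) (_ : InnerProductSpace 𝕜 H) (_ : CompleteSpace H)
    (A : X →L[𝕜] H) (U : H →L[𝕜] H) (B : H →L[𝕜] Y),
    IsSchattenClass p U ∧ T = B ∘L U ∘L A

open scoped ENNReal BoundedContinuousFunction

/-! Factorization: put `l k = ‖x'ₖ‖ ‖yₖ‖`, so that `∑ l ^ s < ∞`. Giving a factor `l ^ (s / 2)` to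
the normalized functionals and another to the normalized vectors leaves `l ^ (1 - s)`, hence `T₁ = B
D A` through `ℓ²` with `D` diagonal (`IsSNuclear.exists_factorization`). Likewise `T₂ = B' D' A'`,
and `V = A' B` is Hilbert–Schmidt. The middle operator is `D' V D`, and Hölder's rule for Schatten
classes predicts `1/r = (1/s - 1) + 1/2 + (1/q - 1)`. In place of Hölder there is a counting
argument: if all coordinates of weight above `t` vanish, the three norm bounds multiply to `t ^ (1 /
r)`. So at most as many singular values exceed `t ^ (1 / r)` as there are weights above `t` in three
summable families, and comparing superlevel sets gives `∑ μ ^ r < ∞`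
(`IsSingularDecomposition.summable_rpow`).

Sharpness: on the bounded functions on a disjoint union of Boolean cubes, `T₁` is a weighted Walsh
matrix on each cube and `T₂` is a diagonal map into the dual. With `N = 2 ^ k` the product is on the
`k`-th cube `c` times the Walsh matrix, where `c` is `N ^ (-(1/s + 1/q))` up to powers of `k + 1`. A
factorization `B U A` with `U ∈ S_p` forces `c * N ^ (3/2 + 1/p)` to stay bounded
(`walsh_factorization_bound`). As `1/s + 1/q = 3/2 + 1/r`, this fails for `p < r`. -/

/-! ### Singular decompositions and counting of singular values. -/

theorem Orthonormal.hasSum_norm_sq {𝕜 : Type*} [RCLike 𝕜] {H ι : Type*} [NormedAddCommGroup H]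
    [InnerProductSpace 𝕜 H] {f : ι → H} (hf : Orthonormal 𝕜 f) {c : ι → 𝕜} {w : H}
    (h : HasSum (fun i => c i • f i) w) : HasSum (fun i => ‖c i‖ ^ 2) (‖w‖ ^ 2) := by
  have h' := (h.norm).pow 2
  refine h'.congr fun s => ?_
  simpa using hf.orthogonalFamily.norm_sum c s

namespace IsSingularDecomposition

variable {𝕜 : Type} [RCLike 𝕜] {H : Type*} [NormedAddCommGroup H] [InnerProductSpace 𝕜 H]
  {U : H →L[𝕜] H} {ι : Type} {e f : ι → H} {μ : ι → ℝ}

theorem hasSum_norm_sq (h : IsSingularDecomposition U e f μ) (x : H) :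
    HasSum (fun i => μ i ^ 2 * ‖inner 𝕜 (e i) x‖ ^ 2) (‖U x‖ ^ 2) := by
  simpa [mul_pow] using h.orthonormal_right.hasSum_norm_sq (h.hasSum x)

theorem apply_left (h : IsSingularDecomposition U e f μ) (i : ι) :
    U (e i) = (μ i : 𝕜) • f i := by
  classical
  refine (h.hasSum (e i)).unique ?_
  convert hasSum_ite_eq i ((μ i : 𝕜) • f i) using 2 with j
  rw [orthonormal_iff_ite.1 h.orthonormal_left]
  split_ifs with hj
  · subst hj; simp
  · simp

theorem norm_apply_left (h : IsSingularDecomposition U e f μ) (i : ι) : ‖U (e i)‖ = μ i := by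
  rw [h.apply_left, norm_smul, h.orthonormal_right.1 i, mul_one, RCLike.norm_ofReal,
    abs_of_pos (h.pos i)]

theorem norm_apply_le (h : IsSingularDecomposition U e f μ) {t : ℝ} (ht : 0 ≤ t) {x : H}
    (hx : ∀ i, t < μ i → inner 𝕜 (e i) x = 0) : ‖U x‖ ≤ t * ‖x‖ := by
  refine le_of_sq_le_sq ?_ (by positivity)
  have hb := (h.orthonormal_left.inner_products_summable x).hasSum.mul_left (t ^ 2)
  calc ‖U x‖ ^ 2 ≤ t ^ 2 * ∑' i, ‖inner 𝕜 (e i) x‖ ^ 2 := by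
        refine hasSum_le (fun i => ?_) (h.hasSum_norm_sq x) hb
        by_cases hi : t < μ i
        · simp [hx i hi]
        · have := (h.pos i).le
          gcongr
          exact not_lt.1 hi
    _ ≤ (t * ‖x‖) ^ 2 := by
        rw [mul_pow]
        gcongr
        exact h.orthonormal_left.tsum_inner_products_le x

/-- The number of singular values exceeding `t` is at most the codimension of any subspace on which
the operator is bounded by `t`. -/
theorem card_le_finrank (h : IsSingularDecomposition U e f μ) {W : Type*} [AddCommGroup W]
    [Module 𝕜 W] [FiniteDimensional 𝕜 W] (L : H →ₗ[𝕜] W) {t : ℝ}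
    (hL : ∀ x, L x = 0 → ‖U x‖ ≤ t * ‖x‖) (G : Finset ι) (hG : ∀ i ∈ G, t < μ i) :
    G.card ≤ Module.finrank 𝕜 W := by
  classical
  by_contra! hlt
  have hG0 : ∃ i, i ∈ G := Finset.card_pos.1 (by omega)
  -- For `t < 0` the bound makes `L` injective, contradicting the dimension count. For `t ≥ 0`, a
  -- nonzero combination of the `e i`, `i ∈ G`, killed by `L` is stretched by more than `t`.
  rcases lt_or_ge t 0 with ht | ht
  · have hz : ∀ x, L x = 0 → x = 0 := fun x hx => by
      by_contra hne
      have := hL x hx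
      have h1 := norm_nonneg (U x)
      have h2 : 0 < ‖x‖ := norm_pos_iff.2 hne
      nlinarith
    let S : (G → 𝕜) →ₗ[𝕜] W := L ∘ₗ Fintype.linearCombination 𝕜 (fun i : G => e i)
    obtain ⟨c, hc, hc0⟩ := (Submodule.ne_bot_iff _).1
      (S.ker_ne_bot_of_finrank_lt (by simpa using hlt))
    have hli := h.orthonormal_left.linearIndependent.comp (fun i : G => (i : ι))
      Subtype.val_injective
    refine hc0 (funext fun i => Fintype.linearIndependent_iff.1 hli c ?_ i)
    simpa [Fintype.linearCombination_apply] using hz _ hc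
  let S : (G → 𝕜) →ₗ[𝕜] W := L ∘ₗ Fintype.linearCombination 𝕜 (fun i : G => e i)
  obtain ⟨c, hc, hc0⟩ := (Submodule.ne_bot_iff _).1
    (S.ker_ne_bot_of_finrank_lt (by simpa using hlt))
  set x : H := ∑ i : G, c i • e i with hx
  have hxL : L x = 0 := by rw [← LinearMap.mem_ker.1 hc]; rfl
  have heG : Orthonormal 𝕜 (fun i : G => e i) := h.orthonormal_left.comp _ Subtype.val_injective
  have hfG : Orthonormal 𝕜 (fun i : G => f i) := h.orthonormal_right.comp _ Subtype.val_injective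
  have hnx : ‖x‖ ^ 2 = ∑ i : G, ‖c i‖ ^ 2 :=
    (heG.hasSum_norm_sq (c := c) (hasSum_fintype _)).unique (hasSum_fintype _)
  have hUx : U x = ∑ i : G, (c i * (μ i : 𝕜)) • f i := by
    simp [hx, map_sum, h.apply_left, smul_smul]
  have hnU : ‖U x‖ ^ 2 = ∑ i : G, ‖c i * (μ i : 𝕜)‖ ^ 2 := by
    rw [hUx]
    exact (hfG.hasSum_norm_sq (c := fun i : G => c i * (μ i : 𝕜)) (hasSum_fintype _)).unique
      (hasSum_fintype _)
  have hle : ‖U x‖ ^ 2 ≤ t ^ 2 * ‖x‖ ^ 2 := by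
    rw [← mul_pow]
    exact pow_le_pow_left₀ (norm_nonneg _) (hL x hxL) 2
  rw [hnU, hnx, Finset.mul_sum] at hle
  obtain ⟨i, hi⟩ := Function.ne_iff.1 hc0
  refine absurd hle (not_le.2 (Finset.sum_lt_sum (fun j _ => ?_) ⟨i, Finset.mem_univ _, ?_⟩))
  · rw [norm_mul, RCLike.norm_ofReal, mul_pow, mul_comm, sq_abs]
    have := (hG j j.2).le
    gcongr
  · rw [norm_mul, RCLike.norm_ofReal, mul_pow, mul_comm, sq_abs]
    have := hG i i.2
    have : 0 < ‖c i‖ := norm_pos_iff.2 hi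
    gcongr

end IsSingularDecomposition

/-! ### Hilbert–Schmidt sums and existence of singular decompositions. -/

/-- Parseval's identity in `ℝ≥0∞`. -/
theorem HilbertBasis.ofReal_norm_sq_eq_tsum {𝕜 : Type*} [RCLike 𝕜] {H κ : Type*}
    [NormedAddCommGroup H] [InnerProductSpace 𝕜 H] (b : HilbertBasis κ 𝕜 H) (x : H) :
    ENNReal.ofReal (‖x‖ ^ 2) = ∑' i, ENNReal.ofReal (‖inner 𝕜 (b i) x‖ ^ 2) := by
  have h : HasSum (fun i => ‖inner 𝕜 (b i) x‖ ^ 2) (‖x‖ ^ 2) := by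
    have := b.hasSum_repr x
    simp only [b.repr_apply_apply] at this
    exact b.orthonormal.hasSum_norm_sq this
  rw [← h.tsum_eq, ENNReal.ofReal_tsum_of_nonneg (fun _ => by positivity) h.summable]

/-- For Hilbert–Schmidt sums, an orthonormal family gives at most as much as a Hilbert basis. -/
theorem Orthonormal.tsum_enorm_apply_sq_le {𝕜 : Type*} [RCLike 𝕜] {H K ι κ : Type*}
    [NormedAddCommGroup H] [InnerProductSpace 𝕜 H] [CompleteSpace H]
    [NormedAddCommGroup K] [InnerProductSpace 𝕜 K] [CompleteSpace K] (U : H →L[𝕜] K)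
    {φ : ι → H} (hφ : Orthonormal 𝕜 φ) (b : HilbertBasis κ 𝕜 H) :
    ∑' l, ENNReal.ofReal (‖U (φ l)‖ ^ 2) ≤ ∑' i, ENNReal.ofReal (‖U (b i)‖ ^ 2) := by
  obtain ⟨w, d, -⟩ := exists_hilbertBasis 𝕜 K
  -- Expanding in a basis of `K` moves `U` onto the basis vectors as its adjoint. After exchanging
  -- the sums, Bessel for `φ` is compared with Parseval for `b`, term by term.
  have key (x : H) : ENNReal.ofReal (‖U x‖ ^ 2) =
      ∑' j, ENNReal.ofReal (‖inner 𝕜 x (U.adjoint (d j))‖ ^ 2) := by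
    rw [d.ofReal_norm_sq_eq_tsum]
    refine tsum_congr fun j => ?_
    rw [ContinuousLinearMap.adjoint_inner_right, ← norm_inner_symm]
  simp_rw [key]
  rw [ENNReal.tsum_comm, ENNReal.tsum_comm (f := fun i j =>
    ENNReal.ofReal (‖inner 𝕜 (b i) (U.adjoint (d j))‖ ^ 2))]
  refine ENNReal.tsum_le_tsum fun j => ?_
  rw [← b.ofReal_norm_sq_eq_tsum, ← ENNReal.ofReal_tsum_of_nonneg (fun _ => by positivity)
    (hφ.inner_products_summable _)]
  exact ENNReal.ofReal_le_ofReal (hφ.tsum_inner_products_le _)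

/-- The eigenvectors of a compact self-adjoint operator contain a Hilbert basis. -/
theorem ContinuousLinearMap.exists_hilbertBasis_eigenvectors {𝕜 : Type u} [RCLike 𝕜] {H : Type v}
    [NormedAddCommGroup H] [InnerProductSpace 𝕜 H] [CompleteSpace H] {G : H →L[𝕜] H}
    (hG : IsCompactOperator G) (hG' : G.IsSymmetric) :
    ∃ (κ : Type (max u v)) (b : HilbertBasis κ 𝕜 H), ∀ i, ∃ ν : 𝕜, G (b i) = ν • b i := by
  have : ∀ ν : 𝕜, CompleteSpace (Module.End.eigenspace (G : Module.End 𝕜 H) ν) := fun ν => by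
    have : IsClosed {x : H | G x = ν • x} := isClosed_eq (by fun_prop) (by fun_prop)
    refine IsClosed.completeSpace_coe (hs := ?_)
    convert this using 1
    ext x
    exact Module.End.mem_eigenspace_iff
  have hex := fun ν : 𝕜 => exists_hilbertBasis 𝕜 (Module.End.eigenspace (G : Module.End 𝕜 H) ν)
  choose w b hb using hex
  have hon := hG'.orthogonalFamily_eigenspaces.orthonormal_sigma_orthonormal
    (fun ν => (b ν).orthonormal)
  refine ⟨_, HilbertBasis.mkOfOrthogonalEqBot hon ?_, ?_⟩
  · rw [eq_bot_iff, ← orthogonalComplement_iSup_eigenspaces_eq_bot hG hG']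
    refine fun x hx => ?_
    rw [Submodule.mem_orthogonal] at hx
    rw [← Submodule.iInf_orthogonal, Submodule.mem_iInf]
    refine fun ν => (Submodule.mem_orthogonal _ _).2 fun y hy => ?_
    have h1 := ((b ν).hasSum_repr ⟨y, hy⟩).mapL (innerSL 𝕜 x ∘L Submodule.subtypeL _)
    rw [inner_eq_zero_symm]
    refine h1.unique ?_
    convert! hasSum_zero with i
    have h2 : inner 𝕜 x (b ν i : H) = 0 := by
      rw [inner_eq_zero_symm]
      exact hx _ (Submodule.subset_span ⟨⟨ν, i⟩, rfl⟩)
    rw [map_smul]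
    simp [h2]
  · rw [HilbertBasis.coe_mkOfOrthogonalEqBot]
    exact fun i => ⟨i.1, Module.End.mem_eigenspace_iff.1 (b i.1 i.2).2⟩

/-- Every compact operator on a Hilbert space has a singular value decomposition. -/
theorem IsCompactOperator.exists_isSingularDecomposition {𝕜 : Type} [RCLike 𝕜] {H : Type}
    [NormedAddCommGroup H] [InnerProductSpace 𝕜 H] [CompleteSpace H] {U : H →L[𝕜] H}
    (hU : IsCompactOperator U) :
    ∃ (ι : Type) (e f : ι → H) (μ : ι → ℝ), IsSingularDecomposition U e f μ := by
  -- In an eigenbasis of `U* U` the images `U (b i)` are pairwise orthogonal; the nonzero ones,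
  -- normalized, form the right-hand family.
  obtain ⟨κ, b, hb⟩ := ContinuousLinearMap.exists_hilbertBasis_eigenvectors
    (G := U.adjoint ∘L U) (hU.clm_comp U.adjoint) (IsSelfAdjoint.isSymmetric
      (ContinuousLinearMap.IsPositive.isSelfAdjoint (ContinuousLinearMap.isPositive_adjoint_comp_self U)))
  have hpos : ∀ i : {i // U (b i) ≠ 0}, 0 < ‖U (b i)‖ := fun i => norm_pos_iff.2 i.2
  have hc : ∀ i : {i // U (b i) ≠ 0}, U (b i) = (‖U (b i)‖ : 𝕜) • ((‖U (b i)‖ : 𝕜)⁻¹ • U (b i)) :=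
    fun i => by
      rw [smul_inv_smul₀]
      exact_mod_cast (hpos i).ne'
  refine ⟨{i // U (b i) ≠ 0}, fun i => b i, fun i => (‖U (b i)‖ : 𝕜)⁻¹ • U (b i),
    fun i => ‖U (b i)‖, ⟨b.orthonormal.comp _ Subtype.val_injective, ⟨fun i => ?_, ?_⟩, hpos, ?_⟩⟩
  · simp [norm_smul, (hpos i).ne']
  · intro i j hij
    obtain ⟨ν, hν⟩ := hb i
    have : inner 𝕜 (U (b i)) (U (b j)) = 0 := by
      rw [← ContinuousLinearMap.adjoint_inner_left, ← ContinuousLinearMap.comp_apply, hν,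
        inner_smul_left, b.orthonormal.2 (fun h => hij (Subtype.ext h)), mul_zero]
    simp only [inner_smul_left, inner_smul_right, this, mul_zero]
  · intro x
    have h := (b.hasSum_repr x).mapL U
    simp only [map_smul, b.repr_apply_apply] at h
    have hsup : Function.support (fun i => inner 𝕜 (b i) x • U (b i)) ⊆ {i | U (b i) ≠ 0} :=
      fun i hi h0 => hi (by simp [h0])
    have h2 := (hasSum_subtype_iff_of_support_subset hsup).2 h
    have h3 : (fun i : {i // U (b i) ≠ 0} =>
        ((‖U (b i)‖ : 𝕜) * inner 𝕜 (b i) x) • ((‖U (b i)‖ : 𝕜)⁻¹ • U (b i))) =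
        (fun i => inner 𝕜 (b i) x • U (b i)) ∘ ((↑) : {i // U (b i) ≠ 0} → κ) := by
      funext i
      conv_rhs => rw [Function.comp_apply, hc i]
      rw [smul_smul _ _ ((‖U (b i)‖ : 𝕜)⁻¹ • U (b i)), mul_comm]
    rw [h3]
    exact h2

/-! ### Analysis, synthesis and diagonal operators on `ℓ²`. -/

theorem lp.hasSum_norm_sq {𝕜 ι : Type*} [RCLike 𝕜] (x : lp (fun _ : ι => 𝕜) 2) :
    HasSum (fun i => ‖x i‖ ^ 2) (‖x‖ ^ 2) := by
  simpa using lp.hasSum_norm (p := 2) (by simp) x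

theorem memℓp_two_of_summable {𝕜 ι : Type*} [RCLike 𝕜] {x : ι → 𝕜}
    (h : Summable fun i => ‖x i‖ ^ 2) : Memℓp x 2 :=
  memℓp_gen (by simpa using h)

/-- Square-summable functionals give an operator into `ℓ²`. -/
theorem exists_analysis_operator {𝕜 : Type*} [RCLike 𝕜] {X ι : Type*} [NormedAddCommGroup X]
    [NormedSpace 𝕜 X] {a : ι → X →L[𝕜] 𝕜} (ha : Summable fun i => ‖a i‖ ^ 2) :
    ∃ A : X →L[𝕜] lp (fun _ : ι => 𝕜) 2, ∀ x i, A x i = a i x := by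
  have hle (x : X) (i : ι) : ‖a i x‖ ^ 2 ≤ ‖a i‖ ^ 2 * ‖x‖ ^ 2 := by
    rw [← mul_pow]
    exact pow_le_pow_left₀ (norm_nonneg _) ((a i).le_opNorm x) 2
  have hs (x : X) : Summable fun i => ‖a i x‖ ^ 2 :=
    .of_nonneg_of_le (fun _ => by positivity) (hle x) (ha.mul_right _)
  let A : X →ₗ[𝕜] lp (fun _ : ι => 𝕜) 2 :=
    { toFun := fun x => ⟨fun i => a i x, memℓp_two_of_summable (hs x)⟩
      map_add' := fun x y => by ext i; exact map_add (a i) x y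
      map_smul' := fun c x => by ext i; simp }
  refine ⟨A.mkContinuous (√(∑' i, ‖a i‖ ^ 2)) fun x => ?_, fun x i => rfl⟩
  refine le_of_sq_le_sq ?_ (by positivity)
  rw [mul_pow, Real.sq_sqrt (tsum_nonneg fun _ => by positivity), ← tsum_mul_right]
  exact hasSum_le (hle x) (lp.hasSum_norm_sq (A x)) (ha.mul_right _).hasSum

section Synthesis

variable {𝕜 : Type*} [RCLike 𝕜] {Y ι : Type*} [NormedAddCommGroup Y] [NormedSpace 𝕜 Y]
  {b : ι → Y}

theorem summable_norm_smul_of_sq (hb : Summable fun i => ‖b i‖ ^ 2)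
    (x : lp (fun _ : ι => 𝕜) 2) : Summable fun i => ‖x i • b i‖ := by
  refine .of_nonneg_of_le (fun _ => norm_nonneg _) (fun i => ?_)
    ((lp.hasSum_norm_sq x).summable.add hb)
  rw [norm_smul]
  nlinarith [sq_nonneg (‖x i‖ - ‖b i‖), sq_nonneg ‖x i‖, sq_nonneg ‖b i‖]

theorem norm_le_of_hasSum_smul (hb : Summable fun i => ‖b i‖ ^ 2) {x : lp (fun _ : ι => 𝕜) 2}
    {y : Y} (hy : HasSum (fun i => x i • b i) y) : ‖y‖ ≤ √(∑' i, ‖b i‖ ^ 2) * ‖x‖ := by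
  have hs := summable_norm_smul_of_sq hb x
  have h1 : ‖y‖ ≤ ∑' i, ‖x i • b i‖ := by
    rw [← hy.tsum_eq]
    exact norm_tsum_le_tsum_norm hs
  have h2 := Real.inner_le_Lp_mul_Lq_tsum_of_nonneg Real.HolderConjugate.two_two
    (fun i => norm_nonneg (x i)) (fun i => norm_nonneg (b i))
    (by simpa using (lp.hasSum_norm_sq x).summable) (by simpa using hb)
  simp only [Real.rpow_two, (lp.hasSum_norm_sq x).tsum_eq, ← Real.sqrt_eq_rpow,
    Real.sqrt_sq (norm_nonneg x)] at h2
  simp only [norm_smul] at h1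
  linarith [mul_comm ‖x‖ √(∑' i, ‖b i‖ ^ 2)]

/-- Square-summable vectors give a compact operator from `ℓ²`. -/
theorem exists_synthesis_operator [CompleteSpace Y] (hb : Summable fun i => ‖b i‖ ^ 2) :
    ∃ B : lp (fun _ : ι => 𝕜) 2 →L[𝕜] Y,
      (∀ x, HasSum (fun i => x i • b i) (B x)) ∧ IsCompactOperator B := by
  classical
  have hs (x : lp (fun _ : ι => 𝕜) 2) := (summable_norm_smul_of_sq hb x).of_norm.hasSum
  let B : lp (fun _ : ι => 𝕜) 2 →ₗ[𝕜] Y :=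
    { toFun := fun x => ∑' i, x i • b i
      map_add' := fun x y => by
        rw [← ((hs x).add (hs y)).tsum_eq]
        simp [add_smul]
      map_smul' := fun c x => by
        rw [RingHom.id_apply, ← ((hs x).const_smul c).tsum_eq]
        simp [smul_smul] }
  let B' := B.mkContinuous _ fun x => norm_le_of_hasSum_smul hb (hs x)
  refine ⟨B', hs, ?_⟩
  -- Finite-rank truncations; the distance to `B'` is at most the square root of the tail of `∑ ‖b
  -- i‖ ^ 2`.
  let F (s : Finset ι) : lp (fun _ : ι => 𝕜) 2 →L[𝕜] Y :=
    ∑ i ∈ s, (lp.evalCLM 𝕜 (fun _ : ι => 𝕜) 2 i).smulRight (b i)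
  refine isCompactOperator_of_tendsto (l := Filter.atTop) (F := F) ?_ (.of_forall fun s => ?_)
  · have h0 := (tendsto_tsum_compl_atTop_zero fun i => ‖b i‖ ^ 2).sqrt
    rw [Real.sqrt_zero] at h0
    rw [tendsto_iff_norm_sub_tendsto_zero]
    refine squeeze_zero (fun _ => norm_nonneg _) (fun s => ?_) h0
    rw [norm_sub_rev]
    refine ContinuousLinearMap.opNorm_le_bound _ (by positivity) fun x => ?_
    let b' : ι → Y := fun i => if i ∈ s then 0 else b i
    have hb' : (fun i => ‖b' i‖ ^ 2) = Set.indicator {i | i ∉ s} (fun i => ‖b i‖ ^ 2) := by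
      funext i
      by_cases hi : i ∈ s <;> simp [b', hi]
    have h1 : HasSum (fun i => x i • b' i) ((B' - F s) x) := by
      have h2 : HasSum (fun i => if i ∈ s then x i • b i else 0) (F s x) := by
        convert! hasSum_sum_of_ne_finset_zero (s := s) (L := .unconditional ι)
          (f := fun i => if i ∈ s then x i • b i else 0) (fun i hi => by simp [hi]) using 1
        simp only [F, sum_apply]
        refine Finset.sum_congr rfl fun i hi => ?_
        rw [if_pos hi]
        rfl
      convert! (hs x).sub h2 using 2 with i
      by_cases hi : i ∈ s <;> simp [b', hi]
    have h3 := norm_le_of_hasSum_smul (by rw [hb']; exact hb.indicator _) h1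
    rw [hb', ← tsum_subtype] at h3
    exact h3
  · refine (compactOperator (RingHom.id 𝕜) (lp (fun _ : ι => 𝕜) 2) Y).sum_mem fun i _ => ?_
    exact (isCompactOperator_of_locallyCompactSpace_dom (lp.evalCLM 𝕜 (fun _ : ι => 𝕜) 2 i)).clm_comp
        (ContinuousLinearMap.toSpanSingleton 𝕜 (b i))

end Synthesis

theorem lp.norm_le_mul_of_forall {𝕜 ι : Type*} [RCLike 𝕜] {x y : lp (fun _ : ι => 𝕜) 2} {C : ℝ}
    (hC : 0 ≤ C) (h : ∀ i, ‖y i‖ ≤ C * ‖x i‖) : ‖y‖ ≤ C * ‖x‖ := by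
  refine le_of_sq_le_sq ?_ (by positivity)
  rw [mul_pow]
  refine hasSum_le (fun i => ?_) (lp.hasSum_norm_sq y) ((lp.hasSum_norm_sq x).mul_left _)
  rw [← mul_pow]
  exact pow_le_pow_left₀ (norm_nonneg _) (h i) 2

theorem exists_diagonal_operator {𝕜 : Type*} [RCLike 𝕜] {ι : Type*} {d : ι → ℝ} {C : ℝ}
    (hd : ∀ i, |d i| ≤ C) (hC : 0 ≤ C) :
    ∃ D : lp (fun _ : ι => 𝕜) 2 →L[𝕜] lp (fun _ : ι => 𝕜) 2, ∀ x i, D x i = (d i : 𝕜) * x i := by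
  have hle (x : lp (fun _ : ι => 𝕜) 2) (i : ι) : ‖(d i : 𝕜) * x i‖ ≤ C * ‖x i‖ := by
    rw [norm_mul, RCLike.norm_ofReal]
    exact mul_le_mul_of_nonneg_right (hd i) (norm_nonneg _)
  have hmem (x : lp (fun _ : ι => 𝕜) 2) : Memℓp (fun i => (d i : 𝕜) * x i) 2 := by
    refine memℓp_two_of_summable (.of_nonneg_of_le (fun _ => by positivity) (fun i => ?_)
      ((lp.hasSum_norm_sq x).summable.mul_left (C ^ 2)))
    rw [← mul_pow]
    exact pow_le_pow_left₀ (norm_nonneg _) (hle x i) 2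
  let D : lp (fun _ : ι => 𝕜) 2 →ₗ[𝕜] lp (fun _ : ι => 𝕜) 2 :=
    { toFun := fun x => ⟨fun i => (d i : 𝕜) * x i, hmem x⟩
      map_add' := fun x y => by ext i; exact mul_add _ (x i) (y i)
      map_smul' := fun c x => by ext i; simp [mul_left_comm] }
  exact ⟨D.mkContinuous C fun x => lp.norm_le_mul_of_forall hC (hle x), fun x i => rfl⟩

/-! ### Comparison of sums by counting superlevel sets. -/

/-- Layer-cake formula for counting measure; it lets sums be compared without ordering the singular
values. -/
theorem tsum_ofReal_eq_lintegral_encard {ι : Type*} {g : ι → ℝ} (hg : ∀ i, 0 ≤ g i) :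
    ∑' i, ENNReal.ofReal (g i) = ∫⁻ t in Set.Ioi 0, ({i | t < g i}.encard : ℝ≥0∞) := by
  let : MeasurableSpace ι := ⊤
  rw [← MeasureTheory.lintegral_count, MeasureTheory.lintegral_eq_lintegral_meas_lt _
    (.of_forall hg) (Measurable.of_discrete).aemeasurable]
  simp only [MeasureTheory.Measure.count_apply (MeasurableSet.of_discrete)]

/-- If every superlevel set of `β` is at most as large as that of the summable family `γ`,
then `β` is summable. -/
theorem summable_of_encard_superlevel_le {ι κ : Type*} {β : ι → ℝ} {γ : κ → ℝ} (hβ : ∀ i, 0 ≤ β i)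
    (hγ : ∀ j, 0 ≤ γ j) (hs : Summable γ)
    (h : ∀ t, 0 < t → {i | t < β i}.encard ≤ {j | t < γ j}.encard) : Summable β := by
  have hle : ∑' i, ENNReal.ofReal (β i) ≤ ∑' j, ENNReal.ofReal (γ j) := by
    rw [tsum_ofReal_eq_lintegral_encard hβ, tsum_ofReal_eq_lintegral_encard hγ]
    exact MeasureTheory.setLIntegral_mono' measurableSet_Ioi fun t ht => by exact_mod_cast h t ht
  have hfin : ∑' i, ENNReal.ofReal (β i) ≠ ⊤ := by
    refine ne_top_of_le_ne_top ?_ hle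
    rw [← ENNReal.ofReal_tsum_of_nonneg hγ hs]
    exact ENNReal.ofReal_ne_top
  simpa [ENNReal.toReal_ofReal, hβ] using ENNReal.summable_toReal hfin

theorem Summable.finite_superlevel {κ : Type*} {γ : κ → ℝ} (hs : Summable γ) {t : ℝ} (ht : 0 < t) :
    {j | t < γ j}.Finite := by
  have := hs.tendsto_cofinite_zero.eventually (gt_mem_nhds ht)
  exact (Filter.eventually_cofinite.1 this).subset fun j hj => not_lt.2 (le_of_lt hj)

/-- Summability of powers of the singular values from a bound by summable weights: the operator is
bounded by `t ^ (1 / r)` on the common kernel of the functionals whose weight exceeds `t`. -/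
theorem IsSingularDecomposition.summable_rpow {𝕜 : Type} [RCLike 𝕜] {H : Type*}
    [NormedAddCommGroup H] [InnerProductSpace 𝕜 H] {U : H →L[𝕜] H} {ι : Type} {e f : ι → H}
    {μ : ι → ℝ} (h : IsSingularDecomposition U e f μ) {κ : Type*} {γ : κ → ℝ} (hγ : ∀ j, 0 ≤ γ j)
    (hs : Summable γ) (g : κ → H →ₗ[𝕜] 𝕜) {r : ℝ} (hr : 0 < r)
    (hg : ∀ t, 0 < t → ∀ x, (∀ j, t < γ j → g j x = 0) → ‖U x‖ ≤ t ^ (1 / r) * ‖x‖) :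
    Summable fun i => μ i ^ r := by
  refine summable_of_encard_superlevel_le (fun i => Real.rpow_nonneg (h.pos i).le _) hγ hs
    fun t ht => ?_
  have hfin := hs.finite_superlevel ht
  by_contra! hlt
  -- One index more than the number of large weights suffices, and keeps `G` finite even if the
  -- superlevel set of `μ ^ r` is not known to be.
  obtain ⟨G, hG, hGc⟩ := Set.exists_subset_encard_eq (Order.add_one_le_of_lt hlt)
  have := hfin.fintype
  have hT : {j | t < γ j}.encard = (Fintype.card {j | t < γ j} : ℕ) := by
    rw [← Set.toFinset_card, ← Set.encard_coe_eq_coe_finsetCard, Set.coe_toFinset]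
  rw [hT] at hGc
  have hGf : G.Finite := Set.encard_ne_top_iff.1 (by rw [hGc]; exact_mod_cast ENat.natCast_ne_top _)
  have hle := h.card_le_finrank (LinearMap.pi fun j : {j | t < γ j} => g j) (t := t ^ (1 / r))
    (fun x hx => hg t ht x fun j hj => congrFun hx ⟨j, hj⟩) hGf.toFinset (fun i hi => by
      have h1 : t < μ i ^ r := hG (hGf.mem_toFinset.1 hi)
      have h2 := Real.rpow_lt_rpow ht.le h1 (one_div_pos.2 hr)
      rwa [← Real.rpow_mul (h.pos i).le, mul_one_div_cancel hr.ne', Real.rpow_one] at h2)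
  rw [hGf.encard_eq_coe_toFinset_card] at hGc
  rw [Module.finrank_fintype_fun_eq_card] at hle
  have : hGf.toFinset.card = Fintype.card {j | t < γ j} + 1 := by exact_mod_cast hGc
  omega

/-! ### Factorization of nuclear operators and of their products. -/

theorem norm_smul_inv_norm_smul_sq_le {𝕜 E : Type*} [RCLike 𝕜] [NormedAddCommGroup E]
    [NormedSpace 𝕜 E] (c : ℝ) (z : E) : ‖(c : 𝕜) • ((‖z‖ : 𝕜)⁻¹ • z)‖ ^ 2 ≤ c ^ 2 := by
  have h : ‖(‖z‖ : 𝕜)⁻¹ • z‖ ≤ 1 := by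
    rw [norm_smul, norm_inv, RCLike.norm_ofReal, abs_norm]
    exact inv_mul_le_one
  rw [norm_smul, mul_pow, RCLike.norm_ofReal, sq_abs]
  exact mul_le_of_le_one_right (sq_nonneg _) (pow_le_one₀ (norm_nonneg _) h)

/-- An `s`-nuclear operator factors as a diagonal operator with entries `l ^ (1 - s)`, where
`∑ l ^ s < ∞`, followed by a compact Hilbert–Schmidt type operator. -/
theorem IsSNuclear.exists_factorization {𝕜 : Type} [RCLike 𝕜]
    {X : Type u} [NormedAddCommGroup X] [NormedSpace 𝕜 X]
    {Y : Type v} [NormedAddCommGroup Y] [NormedSpace 𝕜 Y] [CompleteSpace Y]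
    {s : ℝ} (hs₀ : 0 < s) (hs₁ : s ≤ 1) {T : X →L[𝕜] Y} (hT : IsSNuclear s T) :
    ∃ (l : ℕ → ℝ) (A : X →L[𝕜] lp (fun _ : ℕ => 𝕜) 2)
      (D : lp (fun _ : ℕ => 𝕜) 2 →L[𝕜] lp (fun _ : ℕ => 𝕜) 2) (B : lp (fun _ : ℕ => 𝕜) 2 →L[𝕜] Y),
      (∀ k, 0 ≤ l k) ∧ Summable (fun k => l k ^ s) ∧
      (∀ x k, D x k = ((l k ^ (1 - s) : ℝ) : 𝕜) * x k) ∧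
      IsCompactOperator B ∧ Summable (fun k => ‖B (lp.single 2 k 1)‖ ^ 2) ∧
      T = B ∘L D ∘L A := by
  obtain ⟨a, b, hsum, hT⟩ := hT
  set l : ℕ → ℝ := fun k => ‖a k‖ * ‖b k‖ with hl
  have hl0 (k : ℕ) : 0 ≤ l k := by positivity
  have hls : Summable (fun k => l k ^ s) := by
    simpa only [hl, Real.mul_rpow (norm_nonneg _) (norm_nonneg _)] using hsum
  have hw (k : ℕ) : (l k ^ (s / 2)) ^ 2 = l k ^ s := by
    rw [← Real.rpow_natCast, ← Real.rpow_mul (hl0 k)]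
    norm_num
  obtain ⟨A, hA⟩ := exists_analysis_operator
    (a := fun k => ((l k ^ (s / 2) : ℝ) : 𝕜) • ((‖a k‖ : 𝕜)⁻¹ • a k))
    (.of_nonneg_of_le (fun _ => by positivity) (fun k => hw k ▸ norm_smul_inv_norm_smul_sq_le _ (a k)) hls)
  have hbs : Summable fun k => ‖((l k ^ (s / 2) : ℝ) : 𝕜) • ((‖b k‖ : 𝕜)⁻¹ • b k)‖ ^ 2 :=
    .of_nonneg_of_le (fun _ => by positivity) (fun k => hw k ▸ norm_smul_inv_norm_smul_sq_le _ (b k)) hls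
  obtain ⟨B, hB, hBc⟩ := exists_synthesis_operator (𝕜 := 𝕜) hbs
  -- The constant comes from `l ^ (1 - s) = (l ^ s) ^ ((1 - s) / s)`, each `l k ^ s` being at most
  -- the whole sum.
  obtain ⟨D, hD⟩ := exists_diagonal_operator (𝕜 := 𝕜) (d := fun k => l k ^ (1 - s))
    (C := (∑' k, l k ^ s) ^ ((1 - s) / s)) (fun k => by
      rw [abs_of_nonneg (Real.rpow_nonneg (hl0 k) _)]
      calc l k ^ (1 - s) = (l k ^ s) ^ ((1 - s) / s) := by
            rw [← Real.rpow_mul (hl0 k), mul_div_cancel₀ _ hs₀.ne']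
        _ ≤ _ := Real.rpow_le_rpow (Real.rpow_nonneg (hl0 k) _)
            (hls.le_tsum k fun j _ => Real.rpow_nonneg (hl0 j) _)
            (div_nonneg (by linarith) hs₀.le))
    (Real.rpow_nonneg (tsum_nonneg fun k => Real.rpow_nonneg (hl0 k) _) _)
  refine ⟨l, A, D, B, hl0, hls, hD, hBc, ?_, ?_⟩
  · convert hbs using 4 with k
    refine (hB _).unique ?_
    convert hasSum_ite_eq k (((l k ^ (s / 2) : ℝ) : 𝕜) • ((‖b k‖ : 𝕜)⁻¹ • b k)) using 2 with j
    rw [lp.single_apply]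
    split_ifs with hj
    · subst hj; simp
    · simp [hj]
  · ext x
    refine (hT x).unique ?_
    change HasSum _ (B (D (A x)))
    convert hB (D (A x)) using 2 with k
    rw [hD, hA]
    by_cases h0 : l k = 0
    · have : a k = 0 ∨ b k = 0 := by simpa [hl] using h0
      rcases this with h | h <;> simp [h]
    · have ha : (‖a k‖ : 𝕜) ≠ 0 := by
        exact_mod_cast left_ne_zero_of_mul h0
      have hb : (‖b k‖ : 𝕜) ≠ 0 := by
        exact_mod_cast right_ne_zero_of_mul h0
      have hpow : l k ^ (1 - s) * (l k ^ (s / 2) * l k ^ (s / 2)) = ‖a k‖ * ‖b k‖ := by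
        rw [← pow_two, hw, ← Real.rpow_add (lt_of_le_of_ne (hl0 k) (Ne.symm h0)),
          sub_add_cancel, Real.rpow_one]
      have hpow' : ((l k ^ (1 - s) : ℝ) : 𝕜) * (((l k ^ (s / 2) : ℝ) : 𝕜) *
          ((l k ^ (s / 2) : ℝ) : 𝕜)) = (‖a k‖ : 𝕜) * (‖b k‖ : 𝕜) := by exact_mod_cast hpow
      simp only [smul_apply, smul_eq_mul, smul_smul]
      congr 1
      field_simp
      linear_combination (-(a k x)) * hpow'

/-- On the remaining coordinates `l ^ (1 - s) = (l ^ s) ^ (1 / s - 1)` with `l ^ s ≤ t`, and the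
exponent is nonnegative because `s ≤ 1`. -/
theorem lp.norm_diagonal_le {𝕜 : Type*} [RCLike 𝕜] {ι : Type*} {s : ℝ} (hs₀ : 0 < s) (hs₁ : s ≤ 1)
    {l : ι → ℝ} (hl : ∀ k, 0 ≤ l k) {x y : lp (fun _ : ι => 𝕜) 2}
    (hy : ∀ k, y k = ((l k ^ (1 - s) : ℝ) : 𝕜) * x k) {t : ℝ} (ht : 0 < t)
    (hx : ∀ k, t < l k ^ s → x k = 0) : ‖y‖ ≤ t ^ (1 / s - 1) * ‖x‖ := by
  refine lp.norm_le_mul_of_forall (Real.rpow_nonneg ht.le _) fun k => ?_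
  rw [hy, norm_mul, RCLike.norm_ofReal, abs_of_nonneg (Real.rpow_nonneg (hl k) _)]
  by_cases hk : t < l k ^ s
  · simp [hx k hk]
  · refine mul_le_mul_of_nonneg_right ?_ (norm_nonneg _)
    have h1 : l k ^ (1 - s) = (l k ^ s) ^ (1 / s - 1) := by
      rw [← Real.rpow_mul (hl k)]
      congr 1
      field_simp
    rw [h1]
    refine Real.rpow_le_rpow (Real.rpow_nonneg (hl k) _) (not_lt.1 hk) ?_
    rw [sub_nonneg, le_div_iff₀ hs₀]
    linarith

theorem IsSingularDecomposition.summable_sq {𝕜 : Type} [RCLike 𝕜] {H κ : Type*}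
    [NormedAddCommGroup H] [InnerProductSpace 𝕜 H] [CompleteSpace H] {U : H →L[𝕜] H} {ι : Type}
    {e f : ι → H} {μ : ι → ℝ} (h : IsSingularDecomposition U e f μ) (b : HilbertBasis κ 𝕜 H)
    (hb : Summable fun k => ‖U (b k)‖ ^ 2) : Summable fun i => μ i ^ 2 := by
  have hle := h.orthonormal_left.tsum_enorm_apply_sq_le U b
  have hfin : ∑' i, ENNReal.ofReal (‖U (e i)‖ ^ 2) ≠ ⊤ := by
    refine ne_top_of_le_ne_top ?_ hle
    rw [← ENNReal.ofReal_tsum_of_nonneg (fun _ => by positivity) hb]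
    exact ENNReal.ofReal_ne_top
  refine (ENNReal.summable_toReal hfin).congr fun i => ?_
  rw [h.norm_apply_left, ENNReal.toReal_ofReal (sq_nonneg _)]

theorem IsSchattenClass.conj {𝕜 : Type} [RCLike 𝕜] {H : Type u} {K : Type v}
    [NormedAddCommGroup H] [InnerProductSpace 𝕜 H] [NormedAddCommGroup K] [InnerProductSpace 𝕜 K]
    {p : ℝ} {U : H →L[𝕜] H} (hU : IsSchattenClass p U) (E : H ≃ₗᵢ[𝕜] K) :
    IsSchattenClass p ((E : H →L[𝕜] K) ∘L U ∘L (E.symm : K →L[𝕜] H)) := by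
  obtain ⟨hc, ι, e, f, μ, h, hs⟩ := hU
  refine ⟨(hc.comp_clm (E.symm : K →L[𝕜] H)).clm_comp (E : H →L[𝕜] K), ι, fun i => E (e i),
    fun i => E (f i), μ, ⟨h.orthonormal_left.comp_linearIsometryEquiv E,
      h.orthonormal_right.comp_linearIsometryEquiv E, h.pos, fun x => ?_⟩, hs⟩
  have h1 := (h.hasSum (E.symm x)).mapL (E : H →L[𝕜] K)
  convert! h1 using 2 with i
  have h2 : inner 𝕜 (E (e i)) x = inner 𝕜 (e i) (E.symm x) := by
    rw [← E.inner_map_map, E.apply_symm_apply]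
  simp [h2]

/-- The Hilbert space of the factorization must live in the prescribed universe `h`, so `ℓ²` is
carried there. -/
theorem exists_lp_linearIsometryEquiv_ulift (𝕜 : Type) [RCLike 𝕜] :
    Nonempty (lp (fun _ : ℕ => 𝕜) 2 ≃ₗᵢ[𝕜] lp (fun _ : ULift.{h} ℕ => 𝕜) 2) := by
  let b : HilbertBasis (ULift.{h} ℕ) 𝕜 (lp (fun _ : ULift.{h} ℕ => 𝕜) 2) := ⟨.refl _ _⟩
  have hr : Set.range (b ∘ ULift.up) = Set.range b := ULift.up_surjective.range_comp b
  let b' : HilbertBasis ℕ 𝕜 (lp (fun _ : ULift.{h} ℕ => 𝕜) 2) :=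
    HilbertBasis.mk (b.orthonormal.comp _ ULift.up_injective) (by rw [hr, b.dense_span])
  exact ⟨b'.repr.symm⟩

theorem summable_sumElim {α β : Type*} {f : α → ℝ} {g : β → ℝ} (hf : Summable f)
    (hg : Summable g) : Summable (Sum.elim f g) :=
  (HasSum.sum (f := Sum.elim f g) hf.hasSum hg.hasSum).summable

theorem factorsThroughSchatten_comp_of_isSNuclear {𝕜 : Type} [RCLike 𝕜] {s q r : ℝ}
    (hs₀ : 0 < s) (hs₁ : s ≤ 1) (hq₀ : 0 < q) (hq₁ : q ≤ 1)
    (hr : 1 / r = 1 / s + 1 / q - 3 / 2)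
    {X : Type u} [NormedAddCommGroup X] [NormedSpace 𝕜 X]
    {Y : Type v} [NormedAddCommGroup Y] [NormedSpace 𝕜 Y] [CompleteSpace Y]
    {Z : Type w} [NormedAddCommGroup Z] [NormedSpace 𝕜 Z] [CompleteSpace Z]
    {T₁ : X →L[𝕜] Y} {T₂ : Y →L[𝕜] Z} (h₁ : IsSNuclear s T₁) (h₂ : IsSNuclear q T₂) :
    FactorsThroughSchatten.{h} r (T₂ ∘L T₁) := by
  obtain ⟨l, A, D, B, hl, hls, hD, hB, hBs, rfl⟩ := h₁.exists_factorization hs₀ hs₁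
  obtain ⟨m, A', D', B', hm, hms, hD', -, -, rfl⟩ := h₂.exists_factorization hq₀ hq₁
  have hr0 : 0 < r := by
    have h1 : 1 ≤ 1 / s := by rwa [le_div_iff₀ hs₀, one_mul]
    have h2 : 1 ≤ 1 / q := by rwa [le_div_iff₀ hq₀, one_mul]
    exact one_div_pos.1 (by linarith)
  set V := A' ∘L B with hV
  have hVc : IsCompactOperator V := hB.clm_comp A'
  have hUc : IsCompactOperator (D' ∘L V ∘L D) := (hVc.comp_clm D).clm_comp D'
  obtain ⟨ι₀, e₀, f₀, σ, h0⟩ := hVc.exists_isSingularDecomposition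
  obtain ⟨ι, e, f, μ, hU⟩ := hUc.exists_isSingularDecomposition
  have hσ : Summable fun i => σ i ^ 2 := by
    let b : HilbertBasis ℕ 𝕜 (lp (fun _ : ℕ => 𝕜) 2) := ⟨.refl _ _⟩
    refine h0.summable_sq b (.of_nonneg_of_le (fun _ => by positivity) (fun k => ?_)
      (hBs.mul_left (‖A'‖ ^ 2)))
    have hbk : b k = lp.single 2 k 1 := (b.repr_symm_single k).symm
    rw [← mul_pow, hbk]
    exact pow_le_pow_left₀ (norm_nonneg _) (A'.le_opNorm _) 2
  have hμ : Summable fun i => μ i ^ r := by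
    -- The weights belong to `D`, `V` and `D'`; each functional is pulled back to the domain of `D`,
    -- where `x` lives.
    refine hU.summable_rpow (κ := ℕ ⊕ ι₀ ⊕ ℕ)
      (γ := Sum.elim (fun k => l k ^ s) (Sum.elim (fun i => σ i ^ 2) (fun k => m k ^ q)))
      ?_ (summable_sumElim hls (summable_sumElim hσ hms))
      (Sum.elim (fun k => (lp.evalCLM 𝕜 (fun _ : ℕ => 𝕜) 2 k : _ →ₗ[𝕜] 𝕜))
        (Sum.elim (fun i => ((innerSL 𝕜 (e₀ i) ∘L D : _ →L[𝕜] 𝕜) : _ →ₗ[𝕜] 𝕜))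
          (fun k => ((lp.evalCLM 𝕜 (fun _ : ℕ => 𝕜) 2 k ∘L V ∘L D : _ →L[𝕜] 𝕜) : _ →ₗ[𝕜] 𝕜))))
      hr0 ?_
    · rintro (k | i | k)
      exacts [Real.rpow_nonneg (hl k) _, sq_nonneg _, Real.rpow_nonneg (hm k) _]
    · intro t ht x hx
      have n1 : ‖D x‖ ≤ t ^ (1 / s - 1) * ‖x‖ :=
        lp.norm_diagonal_le hs₀ hs₁ hl (hD x) ht fun k hk => hx (.inl k) hk
      have n2 : ‖V (D x)‖ ≤ t ^ (1 / 2 : ℝ) * ‖D x‖ := by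
        refine h0.norm_apply_le (Real.rpow_nonneg ht.le _) fun i hi => hx (.inr (.inl i)) ?_
        rw [← Real.sqrt_eq_rpow] at hi
        exact (Real.sqrt_lt' (h0.pos i)).1 hi
      have n3 : ‖D' (V (D x))‖ ≤ t ^ (1 / q - 1) * ‖V (D x)‖ :=
        lp.norm_diagonal_le hq₀ hq₁ hm (hD' _) ht fun k hk => hx (.inr (.inr k)) hk
      have hpow : t ^ (1 / r) = t ^ (1 / q - 1) * (t ^ (1 / 2 : ℝ) * t ^ (1 / s - 1)) := by
        rw [← Real.rpow_add ht, ← Real.rpow_add ht, hr]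
        congr 1
        ring
      calc ‖D' (V (D x))‖ ≤ t ^ (1 / q - 1) * (t ^ (1 / 2 : ℝ) * (t ^ (1 / s - 1) * ‖x‖)) := by
            have := Real.rpow_nonneg ht.le (1 / q - 1)
            have := Real.rpow_nonneg ht.le (1 / 2)
            exact n3.trans (by gcongr; exact n2.trans (by gcongr))
        _ = t ^ (1 / r) * ‖x‖ := by rw [hpow]; ring
  obtain ⟨E⟩ := exists_lp_linearIsometryEquiv_ulift.{h} 𝕜
  have hUS : IsSchattenClass r (D' ∘L V ∘L D) := ⟨hUc, ι, e, f, μ, hU, hμ⟩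
  refine ⟨_, inferInstance, inferInstance, inferInstance, (E : _ →L[𝕜] _) ∘L A, _,
    B' ∘L (E.symm : _ →L[𝕜] _), hUS.conj E, ?_⟩
  ext x
  simp [V]

/-! ### Walsh matrices and the lower bound for Hilbert space factorizations. -/

/-- The Walsh function on the Boolean cube. -/
def walsh (𝕜 : Type*) [RCLike 𝕜] {k : ℕ} (a b : Fin k → Bool) : 𝕜 :=
  ∏ i, if a i && b i then -1 else 1

section Walsh

variable (𝕜 : Type*) [RCLike 𝕜] {k : ℕ}

theorem walsh_comm (a b : Fin k → Bool) : walsh 𝕜 a b = walsh 𝕜 b a := by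
  simp [walsh, Bool.and_comm]

theorem norm_walsh (a b : Fin k → Bool) : ‖walsh 𝕜 a b‖ = 1 := by
  rw [walsh, norm_prod]
  exact Finset.prod_eq_one fun i _ => by split_ifs <;> simp

theorem conj_walsh (a b : Fin k → Bool) : starRingEnd 𝕜 (walsh 𝕜 a b) = walsh 𝕜 a b := by
  rw [walsh, map_prod]
  exact Finset.prod_congr rfl fun i _ => by split_ifs <;> simp

theorem sum_walsh_mul_walsh (a b : Fin k → Bool) :
    ∑ c, walsh 𝕜 c a * walsh 𝕜 c b = if a = b then 2 ^ k else 0 := by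
  have h1 : ∑ c, walsh 𝕜 c a * walsh 𝕜 c b = ∏ i : Fin k, ∑ x : Bool,
      (if x && a i then (-1 : 𝕜) else 1) * (if x && b i then -1 else 1) := by
    rw [Finset.prod_univ_sum, Fintype.piFinset_univ]
    simp only [walsh, Finset.prod_mul_distrib]
  have h2 (i : Fin k) : ∑ x : Bool,
      (if x && a i then (-1 : 𝕜) else 1) * (if x && b i then -1 else 1) =
        if a i = b i then 2 else 0 := by
    rcases a i <;> rcases b i <;> norm_num
  rw [h1, Finset.prod_congr rfl fun i _ => h2 i]
  split_ifs with hab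
  · simp [hab]
  · obtain ⟨i, hi⟩ := Function.ne_iff.1 hab
    exact Finset.prod_eq_zero (Finset.mem_univ i) (if_neg hi)

/-- The Walsh matrix divided by `√(2 ^ k)` is unitary, and this persists for Hilbert-space-valued
coefficients. -/
theorem sum_norm_sq_walsh_smul {H : Type*} [NormedAddCommGroup H] [InnerProductSpace 𝕜 H]
    (v : (Fin k → Bool) → H) :
    ∑ a, ‖∑ b, walsh 𝕜 a b • v b‖ ^ 2 = 2 ^ k * ∑ b, ‖v b‖ ^ 2 := by
  have : ((∑ a, ‖∑ b, walsh 𝕜 a b • v b‖ ^ 2 : ℝ) : 𝕜) = ((2 ^ k * ∑ b, ‖v b‖ ^ 2 : ℝ) : 𝕜) := by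
    push_cast
    simp only [← inner_self_eq_norm_sq_to_K (𝕜 := 𝕜), sum_inner, inner_sum, inner_smul_left,
      inner_smul_right, conj_walsh]
    rw [Finset.sum_comm, Finset.mul_sum]
    refine Finset.sum_congr rfl fun b _ => ?_
    simp only [Finset.mul_sum]
    rw [Finset.sum_comm]
    have h1 (b' : Fin k → Bool) : ∑ a, walsh 𝕜 a b * (walsh 𝕜 a b' * inner 𝕜 (v b') (v b)) =
        if b = b' then 2 ^ k * inner 𝕜 (v b') (v b) else 0 := by
      simp only [← mul_assoc, ← Finset.sum_mul, sum_walsh_mul_walsh, ite_mul, zero_mul]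
    rw [Finset.sum_congr rfl fun b' _ => h1 b']
    simp
  exact_mod_cast this

end Walsh

theorem Orthonormal.sum_norm_apply_sq_le {𝕜 : Type*} [RCLike 𝕜] {K ι κ : Type*} [Fintype ι]
    [Fintype κ] [NormedAddCommGroup K] [InnerProductSpace 𝕜 K] [CompleteSpace K]
    (U : EuclideanSpace 𝕜 κ →L[𝕜] K) {φ : ι → EuclideanSpace 𝕜 κ} (hφ : Orthonormal 𝕜 φ) :
    ∑ l, ‖U (φ l)‖ ^ 2 ≤ ∑ i, ‖U (EuclideanSpace.basisFun κ 𝕜 i)‖ ^ 2 := by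
  have h := hφ.tsum_enorm_apply_sq_le U (EuclideanSpace.basisFun κ 𝕜).toHilbertBasis
  rw [tsum_fintype, tsum_fintype, ← ENNReal.ofReal_sum_of_nonneg fun _ _ => by positivity,
    ← ENNReal.ofReal_sum_of_nonneg fun _ _ => by positivity,
    ENNReal.ofReal_le_ofReal_iff (Finset.sum_nonneg fun _ _ => by positivity)] at h
  simpa using h

/-- If a bilinear form built from a Walsh matrix factors through a Hilbert space operator `U`, then
the singular values of `U` cannot be too small. -/
theorem walsh_factorization_bound {𝕜 : Type} [RCLike 𝕜] {X : Type u} [NormedAddCommGroup X]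
    [NormedSpace 𝕜 X] {H : Type v} [NormedAddCommGroup H] [InnerProductSpace 𝕜 H] [CompleteSpace H]
    {k : ℕ} (J : ((Fin k → Bool) → 𝕜) →ₗ[𝕜] X) (hJ : ∀ x, (∀ a, ‖x a‖ ≤ 1) → ‖J x‖ ≤ 1)
    (A : X →L[𝕜] H) {U : H →L[𝕜] H} (B : H →L[𝕜] X →L[𝕜] 𝕜) {c : ℝ} (hc : 0 < c)
    (hT : ∀ x y, B (U (A (J x))) (J y) = (c : 𝕜) * ∑ b, (∑ a, x a * walsh 𝕜 a b) * y b)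
    {ι : Type} {e f : ι → H} {μ : ι → ℝ} (h : IsSingularDecomposition U e f μ) {t : ℝ} (ht : 0 ≤ t)
    (F : Finset ι) (hF : ∀ i, t < μ i → i ∈ F) :
    c * 2 ^ k * (2 ^ k - F.card) ≤ t * (√(2 ^ k) * ‖B‖ * ‖A‖) := by
  let row (a : Fin k → Bool) : X := J fun b => walsh 𝕜 a b
  have hrow (a : Fin k → Bool) : ‖row a‖ ≤ 1 := hJ _ fun b => (norm_walsh 𝕜 a b).le
  -- Riesz vectors of `v ↦ B v (row a)`. Pairing with them applies the Walsh matrix a second time,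
  -- which makes the form `⟨β x, U (α x)⟩` a multiple of `‖x‖ ^ 2`.
  let bv (a : Fin k → Bool) : H := (InnerProductSpace.toDual 𝕜 H).symm (B.flip (row a))
  have hbv (a : Fin k → Bool) (v : H) : inner 𝕜 (bv a) v = B v (row a) := by
    simp [bv]
  have hbn (a : Fin k → Bool) : ‖bv a‖ ≤ ‖B‖ := by
    rw [LinearIsometryEquiv.norm_map, ← B.opNorm_flip]
    exact (B.flip.le_opNorm _).trans (mul_le_of_le_one_right (norm_nonneg _) (hrow a))
  let of : EuclideanSpace 𝕜 (Fin k → Bool) →ₗ[𝕜] ((Fin k → Bool) → 𝕜) := (WithLp.linearEquiv 2 𝕜 ((Fin k → Bool) → 𝕜)).toLinearMap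
  let α : EuclideanSpace 𝕜 (Fin k → Bool) →L[𝕜] H := (A.toLinearMap ∘ₗ J ∘ₗ of).toContinuousLinearMap
  let β : EuclideanSpace 𝕜 (Fin k → Bool) →L[𝕜] H :=
    (Fintype.linearCombination 𝕜 bv ∘ₗ of).toContinuousLinearMap
  have hαd (x : EuclideanSpace 𝕜 (Fin k → Bool)) : α x = A (J fun a => x a) := rfl
  have hβd (x : EuclideanSpace 𝕜 (Fin k → Bool)) : β x = ∑ a, x a • bv a := rfl
  -- Averaging over the Walsh rows, which have sup norm at most `1`, saves a factor `2 ^ k` over the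
  -- termwise estimate.
  have hα : ∑ a, ‖α (EuclideanSpace.basisFun (Fin k → Bool) 𝕜 a)‖ ^ 2 ≤ ‖A‖ ^ 2 := by
    have h1 := sum_norm_sq_walsh_smul 𝕜 fun a => α (EuclideanSpace.basisFun (Fin k → Bool) 𝕜 a)
    have h2 (a : Fin k → Bool) : ∑ b, walsh 𝕜 a b • α (EuclideanSpace.basisFun (Fin k → Bool) 𝕜 b) = A (row a) := by
      simp only [← map_smul, ← map_sum, hαd]
      congr 2
      funext b
      simp [Finset.sum_apply]
    have h3 : ∑ a : Fin k → Bool, ‖A (row a)‖ ^ 2 ≤ 2 ^ k * ‖A‖ ^ 2 := by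
      refine (Finset.sum_le_card_nsmul _ _ (‖A‖ ^ 2) fun a _ => ?_).trans (by simp)
      exact pow_le_pow_left₀ (norm_nonneg _)
        ((A.le_opNorm _).trans (mul_le_of_le_one_right (norm_nonneg _) (hrow a))) 2
    simp only [h2] at h1
    rw [h1] at h3
    exact le_of_mul_le_mul_left h3 (by positivity)
  have hβ : ∑ a, ‖β (EuclideanSpace.basisFun (Fin k → Bool) 𝕜 a)‖ ^ 2 ≤ 2 ^ k * ‖B‖ ^ 2 := by
    have h2 (a : Fin k → Bool) : β (EuclideanSpace.basisFun (Fin k → Bool) 𝕜 a) = bv a := by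
      simp [hβd]
    refine (Finset.sum_le_card_nsmul _ _ (‖B‖ ^ 2) fun a _ => ?_).trans (by simp)
    rw [h2]
    exact pow_le_pow_left₀ (norm_nonneg _) (hbn a) 2
  have key (x : EuclideanSpace 𝕜 (Fin k → Bool)) : inner 𝕜 (β x) (U (α x)) = (c : 𝕜) * (2 ^ k * ‖x‖ ^ 2 : ℝ) := by
    have h1 := sum_norm_sq_walsh_smul 𝕜 fun a => x a
    rw [← EuclideanSpace.norm_sq_eq] at h1
    rw [← h1, hβd, sum_inner]
    simp only [inner_smul_left, hbv, hαd, row, hT]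
    push_cast
    simp only [← RCLike.conj_mul, smul_eq_mul, map_sum, map_mul, conj_walsh]
    simp only [mul_left_comm _ (c : 𝕜), ← Finset.mul_sum]
    congr 1
    simp only [Finset.mul_sum _ _ (starRingEnd 𝕜 _)]
    rw [Finset.sum_comm]
    refine Finset.sum_congr rfl fun b _ => ?_
    rw [Finset.sum_mul]
    refine Finset.sum_congr rfl fun a _ => ?_
    simp only [walsh_comm 𝕜 _ b, mul_comm (x.ofLp _)]
    ring
  -- On `ker L`, of dimension at least `2 ^ k - F.card`, the large singular values are invisible.
  -- Summing the form over an orthonormal basis of this kernel and applying Cauchy–Schwarz brings in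
  -- the Hilbert–Schmidt bounds for `α` and `β`.
  let L : EuclideanSpace 𝕜 (Fin k → Bool) →ₗ[𝕜] (F → 𝕜) :=
    LinearMap.pi fun i : F => (innerSL 𝕜 (e i)).toLinearMap ∘ₗ α.toLinearMap
  let K := LinearMap.ker L
  have hK (x : EuclideanSpace 𝕜 (Fin k → Bool)) (hx : x ∈ K) : ‖U (α x)‖ ≤ t * ‖α x‖ :=
    h.norm_apply_le ht fun i hi => congrFun (LinearMap.mem_ker.1 hx) ⟨i, hF i hi⟩
  have hdim : (2 ^ k - F.card : ℝ) ≤ Module.finrank 𝕜 K := by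
    have h1 := L.finrank_range_add_finrank_ker
    have h2 := (LinearMap.range L).finrank_le
    rw [finrank_euclideanSpace] at h1
    simp only [Module.finrank_fintype_fun_eq_card, Fintype.card_coe] at h2
    have h3 : Fintype.card (Fin k → Bool) = 2 ^ k := by simp
    rw [h3] at h1
    have h4 : 2 ^ k ≤ F.card + Module.finrank 𝕜 K := by
      change Module.finrank 𝕜 (LinearMap.range L) + Module.finrank 𝕜 K = 2 ^ k at h1
      omega
    have h5 : (2 ^ k : ℝ) ≤ F.card + Module.finrank 𝕜 K := by exact_mod_cast h4
    linarith
  let φ (l : Fin (Module.finrank 𝕜 K)) : EuclideanSpace 𝕜 (Fin k → Bool) := stdOrthonormalBasis 𝕜 K l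
  have hφ : Orthonormal 𝕜 φ :=
    (stdOrthonormalBasis 𝕜 K).orthonormal.comp_linearIsometry K.subtypeₗᵢ
  have hterm (l) : c * 2 ^ k ≤ t * (‖β (φ l)‖ * ‖α (φ l)‖) := by
    have h1 := key (φ l)
    rw [hφ.1 l] at h1
    have h2 : c * 2 ^ k = ‖inner 𝕜 (β (φ l)) (U (α (φ l)))‖ := by
      rw [h1, ← RCLike.ofReal_mul, RCLike.norm_ofReal, abs_of_nonneg (by positivity)]
      ring
    rw [h2]
    calc _ ≤ ‖β (φ l)‖ * ‖U (α (φ l))‖ := norm_inner_le_norm _ _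
      _ ≤ ‖β (φ l)‖ * (t * ‖α (φ l)‖) := by
        gcongr
        exact hK _ (stdOrthonormalBasis 𝕜 K l).2
      _ = _ := by ring
  calc c * 2 ^ k * (2 ^ k - F.card) ≤ c * 2 ^ k * Module.finrank 𝕜 K := by gcongr
    _ = ∑ l : Fin (Module.finrank 𝕜 K), c * 2 ^ k := by simp [mul_comm]
    _ ≤ ∑ l, t * (‖β (φ l)‖ * ‖α (φ l)‖) := Finset.sum_le_sum fun l _ => hterm l
    _ = t * ∑ l, ‖β (φ l)‖ * ‖α (φ l)‖ := by rw [Finset.mul_sum]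
    _ ≤ t * (√(∑ l, ‖β (φ l)‖ ^ 2) * √(∑ l, ‖α (φ l)‖ ^ 2)) := by
        gcongr
        exact Real.sum_mul_le_sqrt_mul_sqrt _ _ _
    _ ≤ t * (√(2 ^ k * ‖B‖ ^ 2) * √(‖A‖ ^ 2)) := by
        gcongr
        · exact (hφ.sum_norm_apply_sq_le β).trans hβ
        · exact (hφ.sum_norm_apply_sq_le α).trans hα
    _ = t * (√(2 ^ k) * ‖B‖ * ‖A‖) := by
        rw [Real.sqrt_mul (by positivity), Real.sqrt_sq (norm_nonneg B),
          Real.sqrt_sq (norm_nonneg A)]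

/-! ### The extremal pair of nuclear operators. -/

theorem summable_of_summable_rpow {ι : Type*} {a : ι → ℝ} (ha : ∀ i, 0 ≤ a i) {s : ℝ}
    (hs₀ : 0 < s) (hs₁ : s ≤ 1) (h : Summable fun i => a i ^ s) : Summable a := by
  refine h.of_norm_bounded_eventually ?_
  filter_upwards [h.tendsto_cofinite_zero.eventually (gt_mem_nhds one_pos)] with i hi
  rw [Real.norm_of_nonneg (ha i)]
  have h1 : a i ≤ 1 := by
    by_contra! hlt
    exact absurd (Real.one_le_rpow hlt.le hs₀.le) (not_le.2 hi)
  rcases (ha i).eq_or_lt with h0 | h0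
  · rw [← h0]; positivity
  · simpa using Real.rpow_le_rpow_of_exponent_ge h0 h1 hs₁

theorem exists_isSNuclear {𝕜 : Type} [RCLike 𝕜] {X : Type u} [NormedAddCommGroup X]
    [NormedSpace 𝕜 X] {Y : Type v} [NormedAddCommGroup Y] [NormedSpace 𝕜 Y] [CompleteSpace Y]
    {ι : Type*} [Countable ι] [Infinite ι] {s : ℝ} (hs₀ : 0 < s) (hs₁ : s ≤ 1)
    (x' : ι → X →L[𝕜] 𝕜) (y : ι → Y) (h : Summable fun i => ‖x' i‖ ^ s * ‖y i‖ ^ s) :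
    ∃ T : X →L[𝕜] Y, IsSNuclear s T ∧ ∀ x, HasSum (fun i => x' i x • y i) (T x) := by
  have hs : Summable fun i => ‖x' i‖ * ‖y i‖ :=
    summable_of_summable_rpow (fun i => by positivity) hs₀ hs₁
      (by simpa only [Real.mul_rpow (norm_nonneg _) (norm_nonneg _)] using h)
  have hT : Summable fun i => (x' i).smulRight (y i) := by
    refine Summable.of_norm ?_
    simpa only [ContinuousLinearMap.norm_smulRight_apply] using hs
  have happ (x : X) : HasSum (fun i => x' i x • y i) ((∑' i, (x' i).smulRight (y i)) x) :=
    hT.hasSum.mapL (ContinuousLinearMap.apply 𝕜 Y x)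
  obtain ⟨g⟩ := nonempty_equiv_of_countable (α := ℕ) (β := ι)
  exact ⟨_, ⟨x' ∘ g, y ∘ g, g.summable_iff.2 h, fun x => g.hasSum_iff.2 (happ x)⟩, happ⟩

/-- Disjoint union of the Boolean cubes of all dimensions. -/
abbrev CubeIndex : Type := Σ k : ℕ, (Fin k → Bool)

section Cube

variable (𝕜 : Type) [RCLike 𝕜]

/-- Extension by zero of a function on the `k`-th cube. -/
noncomputable def cubeExtend (k : ℕ) : ((Fin k → Bool) → 𝕜) →ₗ[𝕜] (CubeIndex →ᵇ 𝕜) where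
  toFun x := BoundedContinuousFunction.ofNormedAddCommGroupDiscrete
    (Function.extend (Sigma.mk k) x 0) ‖x‖ fun i => by
      by_cases hi : ∃ a, Sigma.mk k a = i
      · obtain ⟨a, rfl⟩ := hi
        rw [sigma_mk_injective.extend_apply]
        exact norm_le_pi_norm x a
      · rw [Function.extend_apply' _ _ _ hi]
        simp
  map_add' x y := by
    ext i
    by_cases hi : ∃ a, Sigma.mk k a = i
    · obtain ⟨a, rfl⟩ := hi
      simp [sigma_mk_injective.extend_apply]
    · simp [Function.extend_apply' _ _ _ hi]
  map_smul' c x := by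
    ext i
    by_cases hi : ∃ a, Sigma.mk k a = i
    · obtain ⟨a, rfl⟩ := hi
      simp [sigma_mk_injective.extend_apply]
    · simp [Function.extend_apply' _ _ _ hi]

variable {𝕜} {k : ℕ}

@[simp]
theorem cubeExtend_apply_mk (x : (Fin k → Bool) → 𝕜) (a : Fin k → Bool) :
    cubeExtend 𝕜 k x ⟨k, a⟩ = x a :=
  (sigma_mk_injective (β := fun k => Fin k → Bool)).extend_apply x _ a

theorem cubeExtend_apply_of_notMem (x : (Fin k → Bool) → 𝕜) {i : CubeIndex}
    (hi : i ∉ Set.range (Sigma.mk (β := fun k => Fin k → Bool) k)) : cubeExtend 𝕜 k x i = 0 :=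
  Function.extend_apply' _ _ _ hi

theorem norm_cubeExtend_le (x : (Fin k → Bool) → 𝕜) (hx : ∀ a, ‖x a‖ ≤ 1) :
    ‖cubeExtend 𝕜 k x‖ ≤ 1 := by
  refine (BoundedContinuousFunction.norm_le zero_le_one).2 fun i => ?_
  by_cases hi : i ∈ Set.range (Sigma.mk (β := fun k => Fin k → Bool) k)
  · obtain ⟨a, rfl⟩ := hi
    simpa using hx a
  · simp [cubeExtend_apply_of_notMem x hi]

theorem hasSum_cube {E : Type*} [AddCommMonoid E] [TopologicalSpace E] {F : CubeIndex → E}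
    (hF : ∀ i, i ∉ Set.range (Sigma.mk (β := fun k => Fin k → Bool) k) → F i = 0) :
    HasSum F (∑ a : Fin k → Bool, F ⟨k, a⟩) :=
  (sigma_mk_injective.hasSum_iff hF).1 (hasSum_fintype _)

end Cube

/-- Summable weights on the cubes, of size barely below `1 / 2 ^ k`. -/
noncomputable def cubeWeight (k : ℕ) : ℝ := (2 ^ k)⁻¹ * ((k + 1 : ℝ) ^ 2)⁻¹

theorem cubeWeight_pos (k : ℕ) : 0 < cubeWeight k := by
  unfold cubeWeight
  positivity

theorem summable_cubeWeight : Summable fun i : CubeIndex => cubeWeight i.1 := by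
  rw [summable_sigma_of_nonneg fun i => (cubeWeight_pos i.1).le]
  refine ⟨fun k => (hasSum_fintype _).summable, ?_⟩
  have h : Summable fun k : ℕ => ((k + 1 : ℝ) ^ 2)⁻¹ := by
    have := (summable_nat_add_iff 1).2 (Real.summable_nat_pow_inv.2 one_lt_two)
    simpa using this
  refine h.congr fun k => ?_
  rw [tsum_fintype]
  simp [cubeWeight]

/-- A product of an `s`-nuclear and a `q`-nuclear operator which on the `k`-th cube is a multiple of
the Walsh matrix. -/
theorem exists_walsh_product (𝕜 : Type) [RCLike 𝕜] {s q : ℝ}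
    (hs₀ : 0 < s) (hs₁ : s ≤ 1) (hq₀ : 0 < q) (hq₁ : q ≤ 1) :
    ∃ (T₁ : (CubeIndex →ᵇ 𝕜) →L[𝕜] (CubeIndex →ᵇ 𝕜))
      (T₂ : (CubeIndex →ᵇ 𝕜) →L[𝕜] ((CubeIndex →ᵇ 𝕜) →L[𝕜] 𝕜)),
      IsSNuclear s T₁ ∧ IsSNuclear (X := CubeIndex →ᵇ 𝕜) (Y := (CubeIndex →ᵇ 𝕜) →L[𝕜] 𝕜) q T₂ ∧
      ∀ k x y,
        T₂ (T₁ (cubeExtend 𝕜 k x)) (cubeExtend 𝕜 k y) =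
          ((cubeWeight k ^ (1 / s + 1 / q) : ℝ) : 𝕜) *
            ∑ b, (∑ a, x a * walsh 𝕜 a b) * y b := by
  let ev (i : CubeIndex) : (CubeIndex →ᵇ 𝕜) →L[𝕜] 𝕜 := BoundedContinuousFunction.evalCLM 𝕜 i
  have hev (i : CubeIndex) : ‖ev i‖ ≤ 1 :=
    ContinuousLinearMap.opNorm_le_bound _ zero_le_one fun x => by
      rw [one_mul]; exact x.norm_coe_le_norm i
  let row (i : CubeIndex) : CubeIndex →ᵇ 𝕜 := cubeExtend 𝕜 i.1 fun b => walsh 𝕜 i.2 b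
  have hrow (i : CubeIndex) : ‖row i‖ ≤ 1 :=
    norm_cubeExtend_le _ fun b => (norm_walsh 𝕜 _ b).le
  -- Chosen so that the `p`-th power is exactly the summable weight.
  let l (p : ℝ) (i : CubeIndex) : ℝ := cubeWeight i.1 ^ (1 / p)
  have hl (p : ℝ) (i : CubeIndex) : 0 < l p i := Real.rpow_pos_of_pos (cubeWeight_pos _) _
  have hsum {E : Type} [NormedAddCommGroup E] (p : ℝ) (hp : 0 < p) (z : CubeIndex → E)
      (hz : ∀ i, ‖z i‖ ≤ 1) :
      Summable fun i => ‖((l p i : ℝ) : 𝕜) • ev i‖ ^ p * ‖z i‖ ^ p := by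
    refine .of_nonneg_of_le (fun _ => by positivity) (fun i => ?_) summable_cubeWeight
    rw [norm_smul, RCLike.norm_ofReal, abs_of_pos (hl p i)]
    calc _ ≤ (l p i * 1) ^ p * 1 ^ p := by
          have := (hl p i).le
          gcongr
          exacts [hev i, hz i]
      _ = cubeWeight i.1 := by
          rw [Real.one_rpow, mul_one, mul_one, ← Real.rpow_mul (cubeWeight_pos _).le,
            one_div_mul_cancel hp.ne', Real.rpow_one]
  obtain ⟨T₁, h₁, hT₁⟩ := exists_isSNuclear hs₀ hs₁ (fun i => ((l s i : ℝ) : 𝕜) • ev i) row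
    (hsum s hs₀ row hrow)
  obtain ⟨T₂, h₂, hT₂⟩ := exists_isSNuclear hq₀ hq₁ (fun i => ((l q i : ℝ) : 𝕜) • ev i) ev
    (hsum q hq₀ ev hev)
  refine ⟨T₁, T₂, h₁, h₂, fun k x y => ?_⟩
  have e₁ : T₁ (cubeExtend 𝕜 k x) = ∑ a, (((l s ⟨k, a⟩ : ℝ) : 𝕜) * x a) • row ⟨k, a⟩ := by
    refine (hT₁ _).unique ?_
    convert! hasSum_cube (k := k) (fun i hi => ?_) using 3 with a
    · simp [ev]
    · simp [ev, cubeExtend_apply_of_notMem x hi]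
  have e₂ (z : CubeIndex →ᵇ 𝕜) : T₂ z (cubeExtend 𝕜 k y) =
      ∑ b, ((l q ⟨k, b⟩ : ℝ) : 𝕜) * z ⟨k, b⟩ * y b := by
    refine ((hT₂ z).mapL (ContinuousLinearMap.apply 𝕜 𝕜 (cubeExtend 𝕜 k y))).unique ?_
    convert! hasSum_cube (k := k) (fun i hi => ?_) using 3 with b
    · simp [ev]
    · simp [ev, cubeExtend_apply_of_notMem y hi]
  rw [e₂, e₁, Finset.mul_sum]
  refine Finset.sum_congr rfl fun b _ => ?_
  have hsm : (∑ a, (((l s ⟨k, a⟩ : ℝ) : 𝕜) * x a) • row ⟨k, a⟩) ⟨k, b⟩ =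
      ((cubeWeight k ^ (1 / s) : ℝ) : 𝕜) * ∑ a, x a * walsh 𝕜 a b := by
    rw [BoundedContinuousFunction.coe_sum, Finset.sum_apply, Finset.mul_sum]
    refine Finset.sum_congr rfl fun a _ => ?_
    simp [row, l, mul_assoc]
  rw [hsm, Real.rpow_add (cubeWeight_pos k)]
  simp only [l]
  push_cast
  ring

/-! ### Growth rates and sharpness of the exponent. -/

theorem not_forall_pow_le_mul_pow {b : ℝ} (hb : 1 < b) (C : ℝ) (m : ℕ) :
    ¬ ∀ k : ℕ, b ^ k ≤ C * (k + 1 : ℝ) ^ m := by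
  intro h
  have ho := isLittleO_pow_const_const_pow_of_one_lt (R := ℝ) m hb
  have hpos : 0 < (b * (|C| + 1))⁻¹ := by positivity
  obtain ⟨k, hk⟩ := ((Filter.tendsto_add_atTop_nat 1).eventually (ho.def hpos)).exists
  have h1 := h k
  have hbk : 0 < b ^ k := by positivity
  rw [Real.norm_of_nonneg (by positivity), Real.norm_of_nonneg (by positivity), pow_succ] at hk
  have h2 : ((k : ℝ) + 1) ^ m ≤ (|C| + 1)⁻¹ * b ^ k := by
    push_cast at hk
    calc _ ≤ _ := hk
      _ = _ := by field_simp
  have h3 : b ^ k ≤ |C| * ((|C| + 1)⁻¹ * b ^ k) :=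
    h1.trans ((mul_le_mul_of_nonneg_right (le_abs_self C) (by positivity)).trans
      (mul_le_mul_of_nonneg_left h2 (abs_nonneg C)))
  have h4 : |C| * (|C| + 1)⁻¹ < 1 := by
    rw [← div_eq_mul_inv, div_lt_one (by positivity)]
    linarith
  nlinarith

theorem cubeWeight_rpow_le_of_factorsThroughSchatten {𝕜 : Type} [RCLike 𝕜] {a p : ℝ} (hp : 0 < p)
    {T : (CubeIndex →ᵇ 𝕜) →L[𝕜] ((CubeIndex →ᵇ 𝕜) →L[𝕜] 𝕜)}
    (hT : ∀ k x y, T (cubeExtend 𝕜 k x) (cubeExtend 𝕜 k y) =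
      ((cubeWeight k ^ a : ℝ) : 𝕜) * ∑ b, (∑ a, x a * walsh 𝕜 a b) * y b)
    (h : FactorsThroughSchatten.{h} (X := CubeIndex →ᵇ 𝕜) (Y := (CubeIndex →ᵇ 𝕜) →L[𝕜] 𝕜) p T) :
    ∃ C : ℝ, ∀ k : ℕ, cubeWeight k ^ a * ((2 : ℝ) ^ k) ^ (3 / 2 + 1 / p) ≤ C := by
  classical
  obtain ⟨H, _, _, _, A, U, B, ⟨-, ι, e, f, μ, hU, hμ⟩, rfl⟩ := h
  set S := ∑' i, μ i ^ p + 1 with hS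
  have hnn (i : ι) : 0 ≤ μ i ^ p := Real.rpow_nonneg (hU.pos i).le p
  have hS0 : 0 < S := by
    have : 0 ≤ ∑' i, μ i ^ p := tsum_nonneg hnn
    linarith
  refine ⟨2 * ((2 * S) ^ (1 / p) * (‖B‖ * ‖A‖)), fun k => ?_⟩
  set N : ℝ := 2 ^ k with hN
  have hN0 : 0 < N := by positivity
  -- By Chebyshev's inequality at most `N / 2` of the `μ i ^ p` exceed `2 * S / N`, so at least half
  -- of the cube's dimension survives.
  have hτ : 0 < 2 * S / N := by positivity
  have hfin := hμ.finite_superlevel hτ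
  set F := hfin.toFinset with hF
  have hcard : (F.card : ℝ) ≤ N / 2 := by
    have h1 : F.card * (2 * S / N) ≤ S := by
      calc F.card * (2 * S / N) = ∑ i ∈ F, 2 * S / N := by simp
        _ ≤ ∑ i ∈ F, μ i ^ p := Finset.sum_le_sum fun i hi => (hfin.mem_toFinset.1 hi).le
        _ ≤ ∑' i, μ i ^ p := hμ.sum_le_tsum F fun i _ => hnn i
        _ ≤ S := by linarith
    rw [← mul_div_assoc, div_le_iff₀ hN0] at h1
    have h2 : (F.card * 2) * S ≤ N * S := by linarith
    linarith [le_of_mul_le_mul_right h2 hS0]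
  have hmain := walsh_factorization_bound (cubeExtend 𝕜 k) norm_cubeExtend_le A B
    (Real.rpow_pos_of_pos (cubeWeight_pos k) a) (fun x y => hT k x y) hU
    (Real.rpow_nonneg hτ.le (1 / p)) F (fun i hi => by
      refine hfin.mem_toFinset.2 ?_
      have h1 := Real.rpow_lt_rpow (Real.rpow_nonneg hτ.le (1 / p)) hi hp
      rwa [← Real.rpow_mul hτ.le, one_div_mul_cancel hp.ne', Real.rpow_one] at h1)
  rw [← hN] at hmain
  have hw := Real.rpow_pos_of_pos (cubeWeight_pos k) a
  set c := cubeWeight k ^ a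
  have h1 : c * N * (N / 2) ≤ (2 * S / N) ^ (1 / p) * (√N * ‖B‖ * ‖A‖) :=
    le_trans (mul_le_mul_of_nonneg_left (by linarith) (by positivity)) hmain
  rw [Real.div_rpow (by positivity) hN0.le, Real.sqrt_eq_rpow] at h1
  have hNp : 0 < N ^ (1 / p) := Real.rpow_pos_of_pos hN0 _
  have hNh : 0 < N ^ (1 / 2 : ℝ) := Real.rpow_pos_of_pos hN0 _
  have h2 : N ^ (3 / 2 + 1 / p) = N * N ^ (1 / 2 : ℝ) * N ^ (1 / p) := by
    rw [Real.rpow_add hN0, show (3 / 2 : ℝ) = 1 + 1 / 2 by norm_num, Real.rpow_add hN0,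
      Real.rpow_one]
  have h3 : N = N ^ (1 / 2 : ℝ) * N ^ (1 / 2 : ℝ) := by
    rw [← Real.rpow_add hN0]
    norm_num
  rw [h2]
  rw [div_mul_eq_mul_div, le_div_iff₀ hNp] at h1
  refine le_of_mul_le_mul_right ?_ hNh
  calc c * (N * N ^ (1 / 2 : ℝ) * N ^ (1 / p)) * N ^ (1 / 2 : ℝ)
      = c * (N * (N ^ (1 / 2 : ℝ) * N ^ (1 / 2 : ℝ)) * N ^ (1 / p)) := by ring
    _ = 2 * (c * N * (N / 2) * N ^ (1 / p)) := by rw [← h3]; ring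
    _ ≤ 2 * ((2 * S) ^ (1 / p) * (N ^ (1 / 2 : ℝ) * ‖B‖ * ‖A‖)) := by linarith
    _ = _ := by ring

theorem not_factorsThroughSchatten_of_walsh {𝕜 : Type} [RCLike 𝕜] {a p : ℝ}
    (hp : 0 < p) (hap : a < 3 / 2 + 1 / p)
    {T : (CubeIndex →ᵇ 𝕜) →L[𝕜] ((CubeIndex →ᵇ 𝕜) →L[𝕜] 𝕜)}
    (hT : ∀ k x y, T (cubeExtend 𝕜 k x) (cubeExtend 𝕜 k y) =
      ((cubeWeight k ^ a : ℝ) : 𝕜) * ∑ b, (∑ a, x a * walsh 𝕜 a b) * y b) :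
    ¬ FactorsThroughSchatten.{h} (X := CubeIndex →ᵇ 𝕜) (Y := (CubeIndex →ᵇ 𝕜) →L[𝕜] 𝕜) p T := by
  intro h
  obtain ⟨C, hC⟩ := cubeWeight_rpow_le_of_factorsThroughSchatten hp hT h
  -- The loss `((k + 1) ^ 2) ^ a` from the weights is at most the polynomial `(k + 1) ^ (2 * m)`,
  -- which cannot offset exponential growth.
  obtain ⟨m, hm⟩ := exists_nat_ge a
  refine not_forall_pow_le_mul_pow (b := 2 ^ (3 / 2 + 1 / p - a))
    (Real.one_lt_rpow one_lt_two (by linarith)) C (2 * m) fun k => ?_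
  have hk := hC k
  have hN : (0 : ℝ) < 2 ^ k := by positivity
  have hk1 : (0 : ℝ) < ((k : ℝ) + 1) ^ 2 := by positivity
  have h1 : cubeWeight k ^ a * ((2 : ℝ) ^ k) ^ (3 / 2 + 1 / p) =
      (2 ^ (3 / 2 + 1 / p - a)) ^ k / (((k : ℝ) + 1) ^ 2) ^ a := by
    rw [cubeWeight, Real.mul_rpow (by positivity) (by positivity), Real.inv_rpow hN.le,
      Real.inv_rpow hk1.le, ← Real.rpow_natCast (2 ^ (3 / 2 + 1 / p - a)) k,
      ← Real.rpow_mul zero_le_two, mul_comm _ (k : ℝ), Real.rpow_mul zero_le_two,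
      Real.rpow_natCast, Real.rpow_sub hN]
    ring
  have hka : 0 < (((k : ℝ) + 1) ^ 2) ^ a := Real.rpow_pos_of_pos hk1 a
  rw [h1, div_le_iff₀ hka] at hk
  have hC0 : 0 ≤ C := by
    by_contra! hneg
    have : (0 : ℝ) < (2 ^ (3 / 2 + 1 / p - a)) ^ k := by positivity
    nlinarith
  refine hk.trans (mul_le_mul_of_nonneg_left ?_ hC0)
  rw [pow_mul, ← Real.rpow_natCast _ m]
  exact Real.rpow_le_rpow_of_exponent_le (one_le_pow₀ (by simp)) hm

theorem mainTheorem3 (𝕜 : Type) [RCLike 𝕜] (s q r : ℝ)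
    (hs₀ : 0 < s) (hs₁ : s ≤ 1) (hq₀ : 0 < q) (hq₁ : q ≤ 1)
    (hr : 1 / r = 1 / s + 1 / q - 3 / 2) :
    (∀ (X : Type u) [NormedAddCommGroup X] [NormedSpace 𝕜 X] [CompleteSpace X]
       (Y : Type v) [NormedAddCommGroup Y] [NormedSpace 𝕜 Y] [CompleteSpace Y]
       (Z : Type w) [NormedAddCommGroup Z] [NormedSpace 𝕜 Z] [CompleteSpace Z]
       (T₁ : X →L[𝕜] Y) (T₂ : Y →L[𝕜] Z),
       IsSNuclear s T₁ → IsSNuclear q T₂ →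
         FactorsThroughSchatten.{h} r (T₂ ∘L T₁)) ∧
    (∃ (X : Type) (_ : NormedAddCommGroup X) (_ : NormedSpace 𝕜 X) (_ : CompleteSpace X)
       (Y : Type) (_ : NormedAddCommGroup Y) (_ : NormedSpace 𝕜 Y) (_ : CompleteSpace Y)
       (Z : Type) (_ : NormedAddCommGroup Z) (_ : NormedSpace 𝕜 Z) (_ : CompleteSpace Z)
       (T₁ : X →L[𝕜] Y) (T₂ : Y →L[𝕜] Z),
       IsSNuclear s T₁ ∧ IsSNuclear q T₂ ∧
         ∀ p : ℝ, 0 < p → p < r → ¬ FactorsThroughSchatten.{h} p (T₂ ∘L T₁)) := by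

  refine ⟨fun X _ _ _ Y _ _ _ Z _ _ _ T₁ T₂ h₁ h₂ =>
    factorsThroughSchatten_comp_of_isSNuclear hs₀ hs₁ hq₀ hq₁ hr h₁ h₂, ?_⟩
  obtain ⟨T₁, T₂, h₁, h₂, hT⟩ := exists_walsh_product 𝕜 hs₀ hs₁ hq₀ hq₁
  refine ⟨CubeIndex →ᵇ 𝕜, inferInstance, inferInstance, inferInstance,
    CubeIndex →ᵇ 𝕜, inferInstance, inferInstance, inferInstance,
    (CubeIndex →ᵇ 𝕜) →L[𝕜] 𝕜, inferInstance, inferInstance, inferInstance,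
    T₁, T₂, h₁, h₂, fun p hp hpr => ?_⟩
  refine not_factorsThroughSchatten_of_walsh (a := 1 / s + 1 / q) hp ?_ hT
  have := one_div_lt_one_div_of_lt hp hpr
  linarith
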